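/- Let $k,p\ge 1$ and $\ell_1,\ell_2\ge 0$ be integers with $\ell_1+\ell_2<k$, and put $n=k+p$. \emph{Model.} For a finite field $K$ and integers $\alpha,\beta$ with $\alpha=p\beta$, an MSR code with parameters $(n,k,d=n-1,\alpha,\beta)$ over $K$ is a linear systematic code that stores a file $x=(x_1,\dots,x_k)\in(K^\alpha)^k$ on $n$ nodes, $\alpha$ symbols per node: the systematic node $j\in[k]$ stores $x_j$, the $p$ parity nodes store $K$-linear functions of $x$, any $k$ nodes determine $x$, and for every $j\in[k]$ the block $x_j$ is determined by the data downloaded for the repair of node $j$, which consist of $\beta$ symbols from each of the $d=n-1$ other nodes, each symbol being a linear function of the content of the node that sends it. A secure file size $M$ is achieved with such a code against $(\ell_1,\ell_2)$-eavesdroppers with $\mathcal E_2\subseteq[k]$ if there is a randomized encoder that maps a secret $\mathbf f^s$, uniform on $K^M$, to a file $x$ in such a way that $\mathbf f^s$ can be recovered from the content of any $k$ nodes, and $I(\mathbf f^s;\mathbf e)=0$ for all sets of nodes $\mathcal E_1$ and $\mathcal E_2\subseteq[k]$ with $|\mathcal E_1|=\ell_1$, $|\mathcal E_2|=\ell_2$,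 where $\mathbf e$ consists of the content of the nodes in $\mathcal E_1\cup\mathcal E_2$ and of all the data downloaded for the repair of the nodes in $\mathcal E_2$. The secrecy capacity over $K$ for given $\alpha,\beta$ is the largest $M$ that is achieved with some such MSR code and some encoder. \emph{Zigzag code.} Let $F=\mathbb F_q$ and $\alpha=p^k$, and index the symbols $x_{ij}$ ($j\in[k]$) of the $j$-th systematic node by $i\in\mathbb Z_p^k$. The $t$-th symbol of parity node $l\in\{0,\dots,p-1\}$ is a linear combination over $F$ of the symbols in the zigzag set $Z^l_t=\{x_{ij}: i+l e_j=t\}$, the coefficient of $x_{ij}$ being $a_{l,j,i}$. For the repair of systematic node $j$, each of the other $n-1$ nodes sends its symbols with an index in $Y_j=\{i: i\cdot e_j=0\}$, so $\beta=p^{k-1}$. The coefficients $a_{l,j,i}\in F$ are required to be such that any $k$ nodes determine the message. \emph{Secrecy precoding.} Let $K=\mathbb F_{q^m}$, let $y_{ij}\in K$ ($i\in\mathbb Z_p^k$, $j\in[k]$) be linearly independent over $F$, let $$\mathcal M^s=(k-\ell_1-\ell_2)\,p^k\Bigl(1-\frac1p\Bigr)^{\ell_2},$$ and let $\mathbf r$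 consist of $kp^k-\mathcal M^s$ independent uniform symbols of $K$, independent of $\mathbf f^s\in K^{\mathcal M^s}$. With $(f_1,\dots,f_{kp^k})=(\mathbf r,\mathbf f^s)$ and $f(Y)=\sum_{i=1}^{kp^k}f_iY^{q^{i-1}}$, store the array $x_{ij}=f(y_{ij})$ with the zigzag code. \emph{Theorem.} (a) $\mathcal M^s$ is an integer, and there is a $q_0=q_0(k,p)$ such that suitable coefficients of the zigzag code exist over every finite field with at least $q_0$ elements. (b) For every choice of such coefficients, of $K$ and of the points $y_{ij}$, the zigzag code over $K$ is an MSR code with parameters $(n,k,d=n-1,\alpha=p^k,\beta=p^{k-1})$, and with the precoding above it achieves the secure file size $\mathcal M^s$ against $(\ell_1,\ell_2)$-eavesdroppers with $\mathcal E_2\subseteq[k]$. (c) If $\ell_2\le 2$, then every secure file size $M$ that is achieved with an MSR code with parameters $(n,k,d=n-1,\alpha,\beta)$, over any finite field and for any $\alpha,\beta$, satisfies $$M\le(k-\ell_1-\ell_2)\bigl(\alpha-\theta(\alpha,\beta,\ell_2)\bigr),\qquad \theta(\alpha,\beta,0)=0,\quad \theta(\alpha,\beta,1)=\beta,\quad \theta(\alpha,\beta,2)=2\beta-\frac{\beta}{p}.$$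 For $\alpha=p^k$, $\beta=p^{k-1}$ the right-hand side is $\mathcal M^s$, so the code in (b) attains the bound, and $\mathcal M^s$ is the secrecy capacity over $K$ for $\alpha=p^k$, $\beta=p^{k-1}$. -/

import Mathlib

open scoped BigOperators ENNReal

noncomputable section

namespace SecureDSS

/-! ### Probability on finite sets -/

/-- Mutual information `I(X ; Y) = D(P_{XY} ‖ P_X ⊗ P_Y)` of a pair `(X, Y)` with joint law `P`
(used for finite alphabets, which carry the discrete σ-algebra). -/
def mutualInfo {A B : Type*} (P : PMF (A × B)) : ℝ≥0∞ :=
  letI : MeasurableSpace A := ⊤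
  letI : MeasurableSpace B := ⊤
  InformationTheory.klDiv P.toMeasure
    ((P.map Prod.fst).toMeasure.prod (P.map Prod.snd).toMeasure)

/-! ### Storage codes with exact repair of the systematic nodes -/

/-- A linear systematic storage code over the field `K` with `k` systematic nodes (`Sum.inl j`) and
`p` parity nodes (`Sum.inr l`), so `n = k + p`. A file is an array of `k` blocks of `α` symbols,
every node stores `α` symbols, and the systematic node `j` is repaired by contacting all the
`d = n - 1` other nodes: node `i` sends to it the `β` symbols `V_{i,j} x_i`, `V_{i,j} = send i j`,
which are linear functions of its content `x_i`. -/
structure StorageCode (K : Type*) [Field K] (k p α β : ℕ) where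
  parity : Fin p → (Fin k → Fin α → K) →ₗ[K] (Fin α → K)
  send : Fin k ⊕ Fin p → Fin k → (Fin α → K) →ₗ[K] (Fin β → K)

namespace StorageCode

variable {K : Type*} [Field K] {k p α β : ℕ}

/-- The `α` symbols stored on each of the nodes when the file is `x`. -/
def content (C : StorageCode K k p α β) (x : Fin k → Fin α → K) :
    Fin k ⊕ Fin p → Fin α → K
  | Sum.inl j => x j
  | Sum.inr l => C.parity l x

/-- Any `k` out of the `n = k + p` nodes determine the file. -/
def IsMDS (C : StorageCode K k p α β) : Prop :=
  ∀ A : Finset (Fin k ⊕ Fin p), A.card = k → ∀ x x' : Fin k → Fin α → K,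
    (∀ i ∈ A, C.content x i = C.content x' i) → x = x'

/-- Exact repair: the content of a systematic node `j` is a function of the symbols that
all the other nodes send for its repair. -/
def RepairsSystematic (C : StorageCode K k p α β) : Prop :=
  ∀ j : Fin k, ∀ x x' : Fin k → Fin α → K,
    (∀ i : Fin k ⊕ Fin p, i ≠ Sum.inl j →
      C.send i j (C.content x i) = C.send i j (C.content x' i)) → x j = x' j

/-- The code operates at the minimum storage point with `d = n - 1`: the file has size `k α`, any
`k` nodes determine it, and the systematic nodes are repaired exactly from
`β = α / (d - k + 1) = α / p` symbols of each of the `n - 1` other nodes. -/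
structure IsMSR (C : StorageCode K k p α β) : Prop where
  mds : C.IsMDS
  repair : C.RepairsSystematic
  bandwidth : α = p * β

/-- What an eavesdropper sees who reads the nodes in `E₁`, and both the content of the systematic
nodes in `E₂` and all the data downloaded for their repair. -/
def observe (C : StorageCode K k p α β) (E₁ : Finset (Fin k ⊕ Fin p)) (E₂ : Finset (Fin k))
    (x : Fin k → Fin α → K) :
    (E₁ → Fin α → K) × (E₂ → Fin α → K) ×
      ((j : E₂) → {i : Fin k ⊕ Fin p // i ≠ Sum.inl j.1} → Fin β → K) :=
  (fun i => C.content x i.1, fun j => C.content x (Sum.inl j.1),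
    fun j i => C.send i.1 j.1 (C.content x i.1))

variable [Fintype K] {M : ℕ}

/-- The joint law of the secret `s`, which is uniform on `K ^ M`, and of the observation `obs x` of
the file `x` that a randomized encoder `enc` produces from `s`. -/
def jointLaw {O : Type*} (enc : (Fin M → K) → PMF (Fin k → Fin α → K))
    (obs : (Fin k → Fin α → K) → O) : PMF ((Fin M → K) × O) :=
  (PMF.uniformOfFintype (Fin M → K)).bind fun s => (enc s).map fun x => (s, obs x)

/-- Storing on the code `C` the file produced by the randomized encoder `enc` from `M` secret
symbols achieves the secure file size `M` against all `(ℓ₁, ℓ₂)`-eavesdroppers whose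
download-eavesdropped nodes are systematic: the secret can be recovered from any `k` nodes, and
its mutual information with the observation of the eavesdropper is zero. -/
structure AchievesSecureSize (C : StorageCode K k p α β)
    (enc : (Fin M → K) → PMF (Fin k → Fin α → K)) (ℓ₁ ℓ₂ : ℕ) : Prop where
  recover : ∀ A : Finset (Fin k ⊕ Fin p), A.card = k →
    ∃ dec : (A → Fin α → K) → (Fin M → K),
      ∀ s, ∀ x ∈ (enc s).support, dec (fun i => C.content x i.1) = s
  secure : ∀ (E₁ : Finset (Fin k ⊕ Fin p)) (E₂ : Finset (Fin k)),
    E₁.card = ℓ₁ → E₂.card = ℓ₂ → mutualInfo (jointLaw enc (C.observe E₁ E₂)) = 0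

end StorageCode

/-- The secure file sizes that can be achieved over `K` with linear MSR codes (`n = k + p`,
`d = n - 1`, node size `α`, `β` symbols per helper) and arbitrary randomized encoders, against
`(ℓ₁, ℓ₂)`-eavesdroppers whose download-eavesdropped nodes are systematic. The secrecy capacity is
the greatest element of this set. -/
def secureSizes (K : Type*) [Field K] [Fintype K] (k p α β ℓ₁ ℓ₂ : ℕ) : Set ℕ :=
  {M | ∃ C : StorageCode K k p α β, C.IsMSR ∧
    ∃ enc : (Fin M → K) → PMF (Fin k → Fin α → K), C.AchievesSecureSize enc ℓ₁ ℓ₂}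

/-- `θ(α, β, ℓ₂)` for `ℓ₂ ≤ 2`. -/
def theta (p β ℓ₂ : ℕ) : ℝ :=
  if ℓ₂ = 0 then 0 else if ℓ₂ = 1 then (β : ℝ) else 2 * (β : ℝ) - (β : ℝ) / (p : ℝ)

/-- The upper bound `(k - ℓ₁ - ℓ₂) (α - θ(α, β, ℓ₂))` on the secure file size, for `ℓ₂ ≤ 2`. -/
def secrecyBound (k p α β ℓ₁ ℓ₂ : ℕ) : ℝ :=
  ((k : ℝ) - (ℓ₁ : ℝ) - (ℓ₂ : ℝ)) * ((α : ℝ) - theta p β ℓ₂)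

/-! ### Zigzag codes -/

section Zigzag

variable {k p : ℕ}

/-- The vector of `ℤ_p ^ k` associated with an integer in `[0, p ^ k - 1]` (its base `p` digits). -/
def vec (i : Fin (p ^ k)) : Fin k → Fin p := finFunctionFinEquiv.symm i

variable [NeZero p]

/-- The set `Y_j` of the indices `i` with `i · e_j = 0`. -/
def repairSet (j : Fin k) : Finset (Fin (p ^ k)) :=
  Finset.univ.filter fun i => vec i j = 0

theorem card_repairSet (j : Fin k) : (repairSet (p := p) j).card = p ^ (k - 1) := by
  classical
  have h1 : (repairSet (p := p) j).card
      = (Finset.univ.filter fun v : Fin k → Fin p => v j = 0).card := by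
    refine Finset.card_bij (fun i _ => vec i) ?_ ?_ ?_
    · intro i hi
      simpa [repairSet] using hi
    · intro i _ i' _ h
      exact finFunctionFinEquiv.symm.injective h
    · intro v hv
      refine ⟨finFunctionFinEquiv v, ?_, ?_⟩
      · have hv' : v j = 0 := by simpa using hv
        refine Finset.mem_filter.2 ⟨Finset.mem_univ _, ?_⟩
        rw [vec, Equiv.symm_apply_apply]
        exact hv'
      · simp [vec]
  have h2 : (Finset.univ.filter fun v : Fin k → Fin p => v j = 0)
      = Fintype.piFinset fun m : Fin k => if m = j then {0} else Finset.univ := by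
    ext v
    simp only [Finset.mem_filter, Finset.mem_univ, true_and, Fintype.mem_piFinset]
    constructor
    · intro h m
      by_cases hm : m = j
      · subst hm; simp [h]
      · simp [hm]
    · intro h
      simpa using h j
  rw [h1, h2, Fintype.card_piFinset,
    ← Finset.mul_prod_erase Finset.univ _ (Finset.mem_univ j),
    Finset.prod_congr rfl (g := fun _ => p)]
  · simp
  · intro m hm
    simp [Finset.ne_of_mem_erase hm]

/-- The zigzag array code with coefficients `a`: the `t`-th symbol of parity node `l` is the linear
combination, with coefficients `a l j i`, of the symbols `x_{i j}` in the zigzag set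
`Z^l_t = {x_{i j} : i + l e_j = t}`; for the repair of the systematic node `j`, each of the
other nodes sends its symbols with an index in `Y_j`, in increasing order of the index. -/
def zigzagCode {K : Type*} [Field K] (a : Fin p → Fin k → Fin (p ^ k) → K) :
    StorageCode K k p (p ^ k) (p ^ (k - 1)) where
  parity l := LinearMap.pi fun t =>
    ∑ j : Fin k, ∑ i ∈ Finset.univ.filter (fun i => vec i + Pi.single j l = vec t),
      a l j i • (LinearMap.proj (R := K) (φ := fun _ : Fin (p ^ k) => K) i ∘ₗ
        LinearMap.proj (R := K) (φ := fun _ : Fin k => Fin (p ^ k) → K) j)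
  send _ j := LinearMap.funLeft K K ((repairSet j).orderEmbOfFin (card_repairSet j))

end Zigzag

/-! ### Secrecy precoding with a Gabidulin code -/

/-- The value at `y` of the linearized polynomial `∑ i < N, f i * Y ^ (q ^ i)`. -/
def linearizedEval {K : Type*} [Field K] (q : ℕ) {N : ℕ} (f : Fin N → K) (y : K) : K :=
  ∑ i : Fin N, f i * y ^ (q ^ (i : ℕ))

/-- The secrecy precoder: `R` symbols `r`, uniform on `K` and independent, are put in front
of the `M` secret symbols `s`, and the file is the array of the values at the points `y j i` of
the linearized polynomial (with respect to `q`) that has the coefficients `(r, s)`. -/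
def gabidulinEncoder {K : Type*} [Field K] [Fintype K] (q R M : ℕ) {k α : ℕ}
    (y : Fin k → Fin α → K) (s : Fin M → K) : PMF (Fin k → Fin α → K) :=
  (PMF.uniformOfFintype (Fin R → K)).map fun r =>
    fun j i => linearizedEval q (Fin.append r s) (y j i)

/-- The number `(k - ℓ₁ - ℓ₂) p ^ k (1 - 1 / p) ^ ℓ₂` of secret symbols, as a natural number
(for `ℓ₁ + ℓ₂ ≤ k`). -/
def zigzagSecureSize (k p ℓ₁ ℓ₂ : ℕ) : ℕ :=
  (k - ℓ₁ - ℓ₂) * (p ^ (k - ℓ₂) * (p - 1) ^ ℓ₂)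

end SecureDSS

end

open SecureDSS

/-! Upper bound. If nothing leaks, a single observation is compatible with every secret
(`exists_common_observation`). Take all eavesdropped nodes systematic. Files with this observation
agree on the eavesdropped blocks, and in any other block `b` they differ by a vector on which
everything vanishes that `b` sends for the nodes in `E₂`. The file determines the secret, so `M` is
at most the sum of the dimensions of these spaces `unsent` (`AchievesSecureSize.le_sum_finrank`).
Repair with `α = p * β` forces interference alignment: `b` and every parity node discard the same
subspace of the block of `b`, of dimension `α - β` (`IsMSR.ker_send_eq`). For two repaired nodes the
sum of the two discarded subspaces has codimension at most `β / p`
(`IsMSR.mul_finrank_quotient_le`), which yields `theta`.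

Achievability. With a zigzag code, the observation is determined by the eavesdropped contents and
the downloaded symbols of further nodes, `k` nodes in all (`zigzagCode_observe_eq`). These are at
most `R` symbols, `R` being the number of random coefficients. Each is a value of the linearized
polynomial, because its evaluation is `F`-linear and the code has coefficients in `F`. On `R` points
the contribution of the secret is imitated by `R` coefficients (`exists_linearizedEval_eq`), so a
shift of the uniform randomness absorbs it. Recovery is interpolation at `k * p ^ k` independent
points.

Coefficients. The MDS property is the nonvanishing of determinants that are integer polynomials in
the coefficients and stay nonzero over every field, so a large field contains a common nonroot. -/

noncomputable section

namespace SecureDSS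

/-! ### Zero mutual information on finite alphabets -/

theorem mutualInfo_eq_zero_iff {A B : Type*} [Finite A] [Finite B] (P : PMF (A × B)) :
    mutualInfo P = 0 ↔ ∀ a b, P (a, b) = P.map Prod.fst a * P.map Prod.snd b := by
  let _ : MeasurableSpace A := ⊤
  let _ : MeasurableSpace B := ⊤
  have key : ∀ a b, ((P.map Prod.fst).toMeasure.prod (P.map Prod.snd).toMeasure) {(a, b)} =
      P.map Prod.fst a * P.map Prod.snd b := by
    intro a b
    rw [← Set.singleton_prod_singleton, MeasureTheory.Measure.prod_prod,
      PMF.toMeasure_apply_singleton _ _ (measurableSet_singleton _),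
      PMF.toMeasure_apply_singleton _ _ (measurableSet_singleton _)]
  unfold mutualInfo
  rw [InformationTheory.klDiv_eq_zero_iff]
  constructor
  · intro h a b
    rw [← key, ← h, PMF.toMeasure_apply_singleton _ _ (measurableSet_singleton _)]
  · intro h
    refine MeasureTheory.Measure.ext_of_singleton ?_
    rintro ⟨a, b⟩
    rw [key, PMF.toMeasure_apply_singleton _ _ (measurableSet_singleton _), h]

namespace StorageCode

variable {K : Type*} [Field K] [Fintype K] {k p α β M : ℕ}

theorem jointLaw_map_fst {O : Type*} (enc : (Fin M → K) → PMF (Fin k → Fin α → K))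
    (obs : (Fin k → Fin α → K) → O) :
    (jointLaw enc obs).map Prod.fst = PMF.uniformOfFintype (Fin M → K) := by
  simp only [jointLaw, PMF.map_bind, PMF.map_comp]
  conv_rhs => rw [← PMF.bind_pure (PMF.uniformOfFintype (Fin M → K))]
  congr 1
  funext s
  exact PMF.map_const _ s

/-- If the law of the observation does not depend on the secret, nothing is leaked. -/
theorem mutualInfo_jointLaw_eq_zero {O : Type*} [Finite O]
    (enc : (Fin M → K) → PMF (Fin k → Fin α → K)) (obs : (Fin k → Fin α → K) → O)
    (h : ∀ s, (enc s).map obs = (enc 0).map obs) : mutualInfo (jointLaw enc obs) = 0 := by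
  classical
  have hsnd : (jointLaw enc obs).map Prod.snd = (enc 0).map obs := by
    simp only [jointLaw, PMF.map_bind, PMF.map_comp]
    have : (fun s => (enc s).map (Prod.snd ∘ fun x => (s, obs x))) =
        fun _ => (enc 0).map obs := by
      funext s
      exact h s
    rw [this, PMF.bind_const]
  rw [mutualInfo_eq_zero_iff]
  intro s o
  rw [jointLaw_map_fst, hsnd, ← h s]
  rw [jointLaw, PMF.bind_apply, tsum_eq_single s]
  · congr 1
    simp [PMF.map_apply]
  · intro s' hs'
    have : ((enc s').map fun x => (s', obs x)) (s, o) = 0 := by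
      rw [PMF.apply_eq_zero_iff, PMF.mem_support_map_iff]
      rintro ⟨x, -, hx⟩
      exact hs' (Prod.ext_iff.1 hx).1
    rw [this, mul_zero]

/-- Without leakage some observation is compatible with every secret. -/
theorem exists_common_observation {O : Type*} [Finite O]
    (enc : (Fin M → K) → PMF (Fin k → Fin α → K)) (obs : (Fin k → Fin α → K) → O)
    (h : mutualInfo (jointLaw enc obs) = 0) :
    ∃ o, ∀ s, ∃ x ∈ (enc s).support, obs x = o := by
  obtain ⟨x₀, hx₀⟩ := (enc 0).support_nonempty
  rw [mutualInfo_eq_zero_iff] at h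
  refine ⟨obs x₀, fun s => ?_⟩
  have h0 : (0, obs x₀) ∈ (jointLaw enc obs).support := by
    rw [jointLaw, PMF.mem_support_bind_iff]
    exact ⟨0, by simp, by rw [PMF.mem_support_map_iff]; exact ⟨x₀, hx₀, rfl⟩⟩
  have h1 : (jointLaw enc obs).map Prod.snd (obs x₀) ≠ 0 := by
    rw [← PMF.mem_support_iff, PMF.mem_support_map_iff]
    exact ⟨_, h0, rfl⟩
  -- By independence the mass of this pair is a product of two nonzero marginal masses.
  have h2 : (s, obs x₀) ∈ (jointLaw enc obs).support := by
    rw [PMF.mem_support_iff, h, jointLaw_map_fst]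
    refine mul_ne_zero ?_ h1
    rw [← PMF.mem_support_iff]
    simp
  rw [jointLaw, PMF.mem_support_bind_iff] at h2
  obtain ⟨s', -, hs'⟩ := h2
  rw [PMF.mem_support_map_iff] at hs'
  obtain ⟨x, hx, hxe⟩ := hs'
  obtain ⟨rfl, ho⟩ := Prod.ext_iff.1 hxe
  exact ⟨x, hx, ho⟩

end StorageCode

/-! ### MSR codes: interference alignment and the upper bound -/

namespace StorageCode

variable {K : Type*} [Field K] {k p α β : ℕ}

/-- The map by which the block of the systematic node `b` enters the content of parity node `l`. -/
def parityBlock (C : StorageCode K k p α β) (l : Fin p) (b : Fin k) :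
    (Fin α → K) →ₗ[K] (Fin α → K) :=
  C.parity l ∘ₗ LinearMap.single K (fun _ : Fin k => Fin α → K) b

theorem parityBlock_apply (C : StorageCode K k p α β) (l : Fin p) (b : Fin k) (x : Fin α → K) :
    C.parityBlock l b x = C.parity l (Pi.single b x) := rfl

theorem content_zero (C : StorageCode K k p α β) (i : Fin k ⊕ Fin p) : C.content 0 i = 0 := by
  cases i <;> simp [content]

theorem content_sub (C : StorageCode K k p α β) (x x' : Fin k → Fin α → K)
    (n : Fin k ⊕ Fin p) : C.content (x - x') n = C.content x n - C.content x' n := by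
  cases n <;> simp [content]

theorem isMDS_iff_forall_embedding (C : StorageCode K k p α β) :
    C.IsMDS ↔ ∀ g : Fin k ↪ Fin k ⊕ Fin p, ∀ x, (∀ u, C.content x (g u) = 0) → x = 0 := by
  constructor
  · intro h g x hx
    refine h (Finset.univ.map g) (by simp) x 0 ?_
    intro i hi
    obtain ⟨u, -, rfl⟩ := Finset.mem_map.1 hi
    rw [hx, C.content_zero]
  · intro h A hA x x' hxx
    rw [← sub_eq_zero]
    refine h ((A.equivFinOfCardEq hA).symm.toEmbedding.trans (Function.Embedding.subtype _))
      _ fun u => ?_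
    rw [C.content_sub, sub_eq_zero]
    exact hxx _ (Subtype.prop _)

/-- Parity node `l` and the systematic nodes other than `b` are `k` nodes, and the latter store zero
when the file is supported on `b`. -/
theorem IsMDS.parityBlock_injective {C : StorageCode K k p α β} (h : C.IsMDS) (l : Fin p)
    (b : Fin k) : Function.Injective (C.parityBlock l b) := by
  classical
  rw [← LinearMap.ker_eq_bot, LinearMap.ker_eq_bot']
  intro x hx
  have hk : 0 < k := b.pos
  have hcard : (insert (Sum.inr l) (((Finset.univ : Finset (Fin k)).erase b).map
      Function.Embedding.inl) : Finset (Fin k ⊕ Fin p)).card = k := by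
    rw [Finset.card_insert_of_notMem (by simp)]
    simp
    omega
  have := h _ hcard (Pi.single b x) 0 (by
    intro i hi
    rw [content_zero]
    simp only [Finset.mem_insert, Finset.mem_map, Finset.mem_erase] at hi
    rcases hi with rfl | ⟨c, hc, rfl⟩
    · exact hx
    · exact Pi.single_eq_of_ne hc.1 _)
  simpa using congrFun this b

theorem IsMDS.parityBlock_bijective {C : StorageCode K k p α β} (h : C.IsMDS) (l : Fin p)
    (b : Fin k) : Function.Bijective (C.parityBlock l b) :=
  ⟨h.parityBlock_injective l b,
    LinearMap.injective_iff_surjective.1 (h.parityBlock_injective l b)⟩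

/-- What the parity nodes send for the repair of node `j`, as a function of the block of `b`. -/
def parityDownload (C : StorageCode K k p α β) (j b : Fin k) :
    (Fin α → K) →ₗ[K] (Fin p → Fin β → K) :=
  LinearMap.pi fun l => C.send (Sum.inr l) j ∘ₗ C.parityBlock l b

theorem parityDownload_apply (C : StorageCode K k p α β) (j b : Fin k) (x : Fin α → K)
    (l : Fin p) : C.parityDownload j b x l = C.send (Sum.inr l) j (C.parityBlock l b x) := rfl

theorem RepairsSystematic.eq_zero {C : StorageCode K k p α β} (h : C.RepairsSystematic)
    {j : Fin k} {x : Fin k → Fin α → K}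
    (h1 : ∀ b, b ≠ j → C.send (Sum.inl b) j (x b) = 0)
    (h2 : ∀ l, C.send (Sum.inr l) j (C.parity l x) = 0) : x j = 0 := by
  refine h j x 0 ?_
  rintro (b | l) hi
  · have hb : b ≠ j := fun e => hi (by rw [e])
    rw [content_zero, map_zero]
    exact h1 b hb
  · rw [content_zero, map_zero]
    exact h2 l

/-- For a file supported on `j` the other systematic nodes send zero, so repair relies on the parity
nodes alone; they send `p * β = α` symbols, just enough. -/
theorem IsMSR.parityDownload_bijective {C : StorageCode K k p α β} (h : C.IsMSR) (j : Fin k) :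
    Function.Bijective (C.parityDownload j j) := by
  have hinj : Function.Injective (C.parityDownload j j) := by
    rw [← LinearMap.ker_eq_bot, LinearMap.ker_eq_bot']
    intro x hx
    have := h.repair.eq_zero (j := j) (x := Pi.single j x)
      (fun b hb => by rw [Pi.single_eq_of_ne hb, map_zero])
      (fun l => congrFun hx l)
    simpa using this
  refine ⟨hinj, (LinearMap.injective_iff_surjective_of_finrank_eq_finrank ?_).1 hinj⟩
  simp [Module.finrank_pi_fintype, h.bandwidth]

theorem IsMSR.send_parity_surjective {C : StorageCode K k p α β} (h : C.IsMSR) (j : Fin k)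
    (l : Fin p) : Function.Surjective (C.send (Sum.inr l) j) := by
  intro y
  obtain ⟨x, hx⟩ := (h.parityDownload_bijective j).2 fun _ => y
  exact ⟨C.parityBlock l j x, congrFun hx l⟩

/-- Interference alignment: what is not sent by `b` does not enter what the parity nodes send. -/
theorem IsMSR.ker_send_le {C : StorageCode K k p α β} (h : C.IsMSR) {j b : Fin k} (hb : b ≠ j)
    (l : Fin p) : LinearMap.ker (C.send (Sum.inl b) j) ≤
      LinearMap.ker (C.send (Sum.inr l) j ∘ₗ C.parityBlock l b) := by
  intro x hx
  rw [LinearMap.mem_ker] at hx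
  -- The block `z` at `j` cancels the interference of `x`. All helpers then send zero, so repair
  -- gives `z = 0`, and there was no interference.
  obtain ⟨z, hz⟩ := (h.parityDownload_bijective j).2 (-(C.parityDownload j b x))
  have hpar : ∀ l, C.send (Sum.inr l) j (C.parity l (Pi.single j z + Pi.single b x)) = 0 := by
    intro l
    have := congrFun hz l
    rw [parityDownload_apply, Pi.neg_apply, parityDownload_apply] at this
    rw [map_add, map_add, ← parityBlock_apply, ← parityBlock_apply, this, neg_add_cancel]
  have hz0 := h.repair.eq_zero (j := j) (x := Pi.single j z + Pi.single b x) (by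
    intro c hc
    rw [Pi.add_apply, Pi.single_eq_of_ne hc, zero_add]
    rcases eq_or_ne c b with rfl | hcb
    · simpa using hx
    · rw [Pi.single_eq_of_ne hcb, map_zero]) hpar
  rw [Pi.add_apply, Pi.single_eq_same, Pi.single_eq_of_ne hb.symm, add_zero] at hz0
  have := hpar l
  rwa [hz0, Pi.single_zero, zero_add] at this

theorem IsMSR.finrank_ker_comp {C : StorageCode K k p α β} (h : C.IsMSR) (j b : Fin k)
    (l : Fin p) :
    β + Module.finrank K (LinearMap.ker (C.send (Sum.inr l) j ∘ₗ C.parityBlock l b)) = α := by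
  have hs : Function.Surjective (C.send (Sum.inr l) j ∘ₗ C.parityBlock l b) :=
    (h.send_parity_surjective j l).comp (h.mds.parityBlock_bijective l b).2
  have := LinearMap.finrank_range_add_finrank_ker (C.send (Sum.inr l) j ∘ₗ C.parityBlock l b)
  rw [LinearMap.range_eq_top.2 hs, finrank_top] at this
  simpa using this

/-- The right side has codimension exactly `β`, while `b` sends only `β` symbols, so the left side
has codimension at most `β`; the inclusion is an equality. -/
theorem IsMSR.ker_send_eq {C : StorageCode K k p α β} (h : C.IsMSR) {j b : Fin k} (hb : b ≠ j)
    (l : Fin p) : LinearMap.ker (C.send (Sum.inl b) j) =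
      LinearMap.ker (C.send (Sum.inr l) j ∘ₗ C.parityBlock l b) := by
  refine Submodule.eq_of_le_of_finrank_le (h.ker_send_le hb l) ?_
  have h1 := h.finrank_ker_comp j b l
  have h2 := LinearMap.finrank_range_add_finrank_ker (C.send (Sum.inl b) j)
  have h3 := Submodule.finrank_le (LinearMap.range (C.send (Sum.inl b) j))
  simp only [Module.finrank_fintype_fun_eq_card, Fintype.card_fin] at h2 h3
  omega

theorem IsMSR.finrank_ker_send {C : StorageCode K k p α β} (h : C.IsMSR) (hp : 0 < p)
    {j b : Fin k} (hb : b ≠ j) :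
    β + Module.finrank K (LinearMap.ker (C.send (Sum.inl b) j)) = α := by
  rw [h.ker_send_eq hb ⟨0, hp⟩]
  exact h.finrank_ker_comp j b _

/-- The `p` parity nodes give `p` maps from the block of `j₁` to the quotient. Jointly they are
onto, since the parity downloads for `j₁` are arbitrary, yet they factor through the `β` symbols
that `j₁` sends for `j₂`. -/
theorem IsMSR.mul_finrank_quotient_le {C : StorageCode K k p α β} (h : C.IsMSR) (hp : 0 < p)
    {j₁ j₂ b : Fin k} (h₁ : b ≠ j₁) (h₂ : b ≠ j₂) (hj : j₁ ≠ j₂) :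
    p * Module.finrank K ((Fin α → K) ⧸
      (LinearMap.ker (C.send (Sum.inl b) j₁) ⊔ LinearMap.ker (C.send (Sum.inl b) j₂))) ≤ β := by
  set X := LinearMap.ker (C.send (Sum.inl b) j₁) ⊔ LinearMap.ker (C.send (Sum.inl b) j₂) with hX
  let e : Fin p → Fin k → (Fin α → K) ≃ₗ[K] (Fin α → K) := fun l c =>
    LinearEquiv.ofBijective (C.parityBlock l c) (h.mds.parityBlock_bijective l c)
  -- `T l x` is the block that, placed at `b`, affects parity `l` as `x` does at `j₁`.
  let T : Fin p → (Fin α → K) ≃ₗ[K] (Fin α → K) := fun l => (e l j₁).trans (e l b).symm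
  have hT : ∀ l x, C.parityBlock l b (T l x) = C.parityBlock l j₁ x := fun l x =>
    (e l b).apply_symm_apply (e l j₁ x)
  let Φ : (Fin α → K) →ₗ[K] (Fin p → (Fin α → K) ⧸ X) :=
    LinearMap.pi fun l => X.mkQ ∘ₗ (T l).toLinearMap
  have hsurj : Function.Surjective Φ := by
    intro y
    choose z hz using fun l => Submodule.mkQ_surjective X (y l)
    obtain ⟨x, hx⟩ := (h.parityDownload_bijective j₁).2
      fun l => C.send (Sum.inr l) j₁ (C.parityBlock l b (z l))
    refine ⟨x, funext fun l => ?_⟩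
    change X.mkQ (T l x) = y l
    rw [← hz l, ← sub_eq_zero, ← map_sub, Submodule.mkQ_apply, Submodule.Quotient.mk_eq_zero]
    refine Submodule.mem_sup_left ?_
    rw [h.ker_send_eq h₁ l, LinearMap.mem_ker, LinearMap.comp_apply, map_sub, map_sub, hT,
      sub_eq_zero]
    exact congrFun hx l
  have hker : LinearMap.ker (C.send (Sum.inl j₁) j₂) ≤ LinearMap.ker Φ := by
    intro x hx
    rw [LinearMap.mem_ker]
    refine funext fun l => ?_
    change X.mkQ (T l x) = 0
    rw [Submodule.mkQ_apply, Submodule.Quotient.mk_eq_zero]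
    refine Submodule.mem_sup_right ?_
    rw [h.ker_send_eq hj l] at hx
    rw [h.ker_send_eq h₂ l, LinearMap.mem_ker, LinearMap.comp_apply, hT]
    exact hx
  have h1 := Submodule.finrank_mono hker
  have h2 := h.finrank_ker_send hp hj
  have h3 := LinearMap.finrank_range_add_finrank_ker Φ
  rw [LinearMap.range_eq_top.2 hsurj, finrank_top, Module.finrank_pi_fintype] at h3
  simp only [Finset.sum_const, Finset.card_univ, Fintype.card_fin, smul_eq_mul,
    Module.finrank_fintype_fun_eq_card] at h3
  omega

theorem IsMSR.exists_finrank_inf {C : StorageCode K k p α β} (h : C.IsMSR) (hp : 0 < p)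
    {j₁ j₂ b : Fin k} (h₁ : b ≠ j₁) (h₂ : b ≠ j₂) (hj : j₁ ≠ j₂) :
    ∃ c, p * c ≤ β ∧ Module.finrank K
      (LinearMap.ker (C.send (Sum.inl b) j₁) ⊓ LinearMap.ker (C.send (Sum.inl b) j₂) :
        Submodule K (Fin α → K)) + 2 * β = α + c := by
  refine ⟨_, h.mul_finrank_quotient_le hp h₁ h₂ hj, ?_⟩
  have h1 := h.finrank_ker_send hp h₁
  have h2 := h.finrank_ker_send hp h₂
  have h3 := Submodule.finrank_sup_add_finrank_inf_eq
    (LinearMap.ker (C.send (Sum.inl b) j₁)) (LinearMap.ker (C.send (Sum.inl b) j₂))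
  have h4 := Submodule.finrank_quotient_add_finrank
    (LinearMap.ker (C.send (Sum.inl b) j₁) ⊔ LinearMap.ker (C.send (Sum.inl b) j₂))
  simp only [Module.finrank_fintype_fun_eq_card, Fintype.card_fin] at h4
  omega

/-- The vectors on which everything vanishes that `b` sends for the repair of nodes in `E`. -/
def unsent (C : StorageCode K k p α β) (E : Finset (Fin k)) (b : Fin k) :
    Submodule K (Fin α → K) :=
  ⨅ j ∈ E, LinearMap.ker (C.send (Sum.inl b) j)

theorem AchievesSecureSize.le_sum_finrank [Fintype K] {C : StorageCode K k p α β} {M ℓ₁ ℓ₂ : ℕ}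
    {enc : (Fin M → K) → PMF (Fin k → Fin α → K)} (h : C.AchievesSecureSize enc ℓ₁ ℓ₂)
    {E₁ E₂ : Finset (Fin k)} (h₁ : E₁.card = ℓ₁) (h₂ : E₂.card = ℓ₂) :
    M ≤ ∑ b : ↥((E₁ ∪ E₂)ᶜ : Finset (Fin k)), Module.finrank K (C.unsent E₂ b) := by
  classical
  obtain ⟨o, ho⟩ := exists_common_observation enc _
    (h.secure (E₁.map Function.Embedding.inl) E₂ (by rw [Finset.card_map, h₁]) h₂)
  obtain ⟨dec, hdec⟩ := h.recover (Finset.univ.map Function.Embedding.inl) (by simp)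
  choose x hx hxo using ho
  have hobs : ∀ s s', C.observe (E₁.map Function.Embedding.inl) E₂ (x s) =
      C.observe (E₁.map Function.Embedding.inl) E₂ (x s') := fun s s' => by rw [hxo, hxo]
  have hE1 : ∀ s s', ∀ b ∈ E₁, x s b = x s' b := by
    intro s s' b hb
    exact congrFun (congrArg Prod.fst (hobs s s')) ⟨Sum.inl b, by simpa using hb⟩
  have hE2 : ∀ s s', ∀ b ∈ E₂, x s b = x s' b := by
    intro s s' b hb
    exact congrFun (congrArg (fun o => o.2.1) (hobs s s')) ⟨b, hb⟩
  have hsend : ∀ s s', ∀ b ∉ E₂, x s b - x s' b ∈ C.unsent E₂ b := by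
    intro s s' b hb
    simp only [unsent, Submodule.mem_iInf, LinearMap.mem_ker, map_sub, sub_eq_zero]
    intro j hj
    have hne : (Sum.inl b : Fin k ⊕ Fin p) ≠ Sum.inl j := by
      intro e
      exact hb (Sum.inl_injective e ▸ hj)
    exact congrFun (congrFun (congrArg (fun o => o.2.2) (hobs s s')) ⟨j, hj⟩) ⟨Sum.inl b, hne⟩
  let f : (Fin M → K) → (b : ↥((E₁ ∪ E₂)ᶜ : Finset (Fin k))) → C.unsent E₂ b := fun s b =>
    ⟨x s b - x 0 b, hsend s 0 b fun hb => by
      have := b.2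
      simp [hb] at this⟩
  have hf : Function.Injective f := by
    intro s s' hs
    have hxx : x s = x s' := by
      funext b
      by_cases h1 : b ∈ E₁
      · exact hE1 s s' b h1
      by_cases h2 : b ∈ E₂
      · exact hE2 s s' b h2
      have := congrArg Subtype.val (congrFun hs ⟨b, by simp [h1, h2]⟩)
      simpa [f] using this
    rw [← hdec s (x s) (hx s), ← hdec s' (x s') (hx s'), hxx]
  -- Counting replaces entropy: `f` is not linear, but both sides are powers of the order of `K`.
  have := Nat.card_le_card_of_injective f hf
  rw [Module.natCard_eq_pow_finrank (K := K) (V := Fin M → K), Nat.card_pi,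
    Finset.prod_congr rfl fun b _ =>
      Module.natCard_eq_pow_finrank (K := K) (V := C.unsent E₂ b.1),
    Finset.prod_pow_eq_pow_sum, Module.finrank_fintype_fun_eq_card, Fintype.card_fin] at this
  exact (Nat.pow_le_pow_iff_right Finite.one_lt_card).1 this

theorem IsMSR.finrank_unsent_le {C : StorageCode K k p α β} (h : C.IsMSR) (hp : 0 < p)
    {E : Finset (Fin k)} (hE : E.card ≤ 2) {b : Fin k} (hb : b ∉ E) :
    (Module.finrank K (C.unsent E b) : ℝ) ≤ α - theta p β E.card := by
  obtain h0 | h1 | h2 : E.card = 0 ∨ E.card = 1 ∨ E.card = 2 := by omega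
  · have := Submodule.finrank_le (C.unsent E b)
    simp only [Module.finrank_fintype_fun_eq_card, Fintype.card_fin] at this
    simpa [theta, h0] using this
  · obtain ⟨j, rfl⟩ := Finset.card_eq_one.1 h1
    have := h.finrank_ker_send hp (b := b) (j := j) (by simpa using hb)
    have hu : C.unsent {j} b = LinearMap.ker (C.send (Sum.inl b) j) := by
      rw [unsent, Finset.iInf_singleton]
    rw [hu, h1]
    simp only [theta]
    have : (β : ℝ) + (Module.finrank K (LinearMap.ker (C.send (Sum.inl b) j)) : ℝ) = α := by
      exact_mod_cast this
    norm_num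
    linarith
  · obtain ⟨j₁, j₂, hj, rfl⟩ := Finset.card_eq_two.1 h2
    simp only [Finset.mem_insert, Finset.mem_singleton, not_or] at hb
    obtain ⟨c, hc, hc'⟩ := h.exists_finrank_inf hp hb.1 hb.2 hj
    have hu : C.unsent {j₁, j₂} b =
        LinearMap.ker (C.send (Sum.inl b) j₁) ⊓ LinearMap.ker (C.send (Sum.inl b) j₂) := by
      rw [unsent, Finset.iInf_insert, Finset.iInf_singleton]
    rw [hu, h2]
    have hp' : (0 : ℝ) < p := by exact_mod_cast hp
    have hcp : (c : ℝ) ≤ β / p := by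
      rw [le_div_iff₀ hp', mul_comm]
      exact_mod_cast hc
    have : (Module.finrank K (LinearMap.ker (C.send (Sum.inl b) j₁) ⊓
        LinearMap.ker (C.send (Sum.inl b) j₂) : Submodule K (Fin α → K)) : ℝ) + 2 * β = α + c := by
      exact_mod_cast hc'
    simp only [theta]
    norm_num
    linarith

end StorageCode

/-- The upper bound on the secure file size. -/
theorem le_secrecyBound_of_mem_secureSizes {K : Type*} [Field K] [Fintype K]
    {k p α β ℓ₁ ℓ₂ M : ℕ} (hp : 0 < p) (hℓ : ℓ₁ + ℓ₂ < k) (h₂ : ℓ₂ ≤ 2)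
    (hM : M ∈ secureSizes K k p α β ℓ₁ ℓ₂) : (M : ℝ) ≤ secrecyBound k p α β ℓ₁ ℓ₂ := by
  obtain ⟨C, hC, enc, henc⟩ := hM
  -- A single eavesdropper, with disjoint systematic sets, suffices for the bound.
  obtain ⟨E₁, -, hE₁⟩ := Finset.exists_subset_card_eq (s := (Finset.univ : Finset (Fin k)))
    (n := ℓ₁) (by simp; omega)
  obtain ⟨E₂, hsub, hE₂⟩ := Finset.exists_subset_card_eq (s := E₁ᶜ)
    (n := ℓ₂) (by rw [Finset.card_compl, hE₁, Fintype.card_fin]; omega)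
  have hdisj : Disjoint E₁ E₂ := by
    rw [disjoint_comm, ← Finset.subset_compl_iff_disjoint_right]
    exact hsub
  have hcard : ((E₁ ∪ E₂)ᶜ : Finset (Fin k)).card = k - ℓ₁ - ℓ₂ := by
    rw [Finset.card_compl, Finset.card_union_of_disjoint hdisj, hE₁, hE₂, Fintype.card_fin]
    omega
  calc (M : ℝ) ≤ ((∑ b : ↥((E₁ ∪ E₂)ᶜ : Finset (Fin k)),
        Module.finrank K (C.unsent E₂ b) : ℕ) : ℝ) := by
        exact_mod_cast henc.le_sum_finrank hE₁ hE₂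
    _ ≤ ∑ _b : ↥((E₁ ∪ E₂)ᶜ : Finset (Fin k)), ((α : ℝ) - theta p β ℓ₂) := by
        rw [Nat.cast_sum]
        refine Finset.sum_le_sum fun b _ => ?_
        rw [← hE₂]
        refine hC.finrank_unsent_le hp (hE₂ ▸ h₂) fun hb => ?_
        have := b.2
        simp [hb] at this
    _ = secrecyBound k p α β ℓ₁ ℓ₂ := by
        rw [Finset.sum_const, Finset.card_univ, Fintype.card_coe, hcard, nsmul_eq_mul,
          secrecyBound, Nat.cast_sub (by omega), Nat.cast_sub (by omega)]

/-! ### Zigzag codes: coefficients with the MDS property, and repair -/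

section Zigzag

variable {k p : ℕ}

theorem vec_injective : Function.Injective (vec : Fin (p ^ k) → Fin k → Fin p) :=
  finFunctionFinEquiv.symm.injective

theorem vec_finFunctionFinEquiv (v : Fin k → Fin p) : vec (finFunctionFinEquiv v) = v :=
  finFunctionFinEquiv.symm_apply_apply v

variable [NeZero p]

/-- The index `i` of the symbol of the systematic node `j` in the zigzag set `Z^l_t`. -/
def zigzagIndex (t : Fin (p ^ k)) (j : Fin k) (l : Fin p) : Fin (p ^ k) :=
  finFunctionFinEquiv (vec t - Pi.single j l)

theorem vec_zigzagIndex (t : Fin (p ^ k)) (j : Fin k) (l : Fin p) :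
    vec (zigzagIndex t j l) = vec t - Pi.single j l :=
  vec_finFunctionFinEquiv _

theorem vec_zigzagIndex_of_ne (t : Fin (p ^ k)) {j j' : Fin k} (h : j' ≠ j) (l : Fin p) :
    vec (zigzagIndex t j l) j' = vec t j' := by
  rw [vec_zigzagIndex, Pi.sub_apply, Pi.single_eq_of_ne h, sub_zero]

theorem eq_zigzagIndex_iff (t i : Fin (p ^ k)) (j : Fin k) (l : Fin p) :
    i = zigzagIndex t j l ↔ vec i + Pi.single j l = vec t := by
  rw [← vec_injective.eq_iff, vec_zigzagIndex, eq_sub_iff_add_eq]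

/-- The zigzag set of parity node `l` to which the symbol `x_{i j}` belongs. -/
theorem exists_eq_zigzagIndex (i : Fin (p ^ k)) (j : Fin k) (l : Fin p) :
    ∃ t, i = zigzagIndex t j l ∧ vec t = vec i + Pi.single j l :=
  ⟨finFunctionFinEquiv (vec i + Pi.single j l), by
    rw [eq_zigzagIndex_iff, vec_finFunctionFinEquiv], vec_finFunctionFinEquiv _⟩

theorem mem_repairSet {i : Fin (p ^ k)} {j : Fin k} : i ∈ repairSet j ↔ vec i j = 0 := by
  simp [repairSet]

variable {K : Type*} [Field K] (a : Fin p → Fin k → Fin (p ^ k) → K)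

theorem zigzagCode_parity_apply (l : Fin p) (x : Fin k → Fin (p ^ k) → K) (t : Fin (p ^ k)) :
    (zigzagCode a).parity l x t =
      ∑ j, a l j (zigzagIndex t j l) * x j (zigzagIndex t j l) := by
  have h : ∀ j : Fin k, (Finset.univ.filter fun i => vec i + Pi.single j l = vec t) =
      {zigzagIndex t j l} := by
    intro j
    ext i
    rw [Finset.mem_filter, Finset.mem_singleton, eq_zigzagIndex_iff]
    simp
  simp [zigzagCode, h]

theorem zigzagCode_send_eq_iff (n : Fin k ⊕ Fin p) (j : Fin k) (u v : Fin (p ^ k) → K) :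
    (zigzagCode a).send n j u = (zigzagCode a).send n j v ↔ ∀ i ∈ repairSet j, u i = v i := by
  constructor
  · intro h i hi
    obtain ⟨s, rfl⟩ : i ∈ Set.range ((repairSet j).orderEmbOfFin (card_repairSet j)) := by
      rw [Finset.range_orderEmbOfFin]
      exact hi
    exact congrFun h s
  · intro h
    funext s
    exact h _ (Finset.orderEmbOfFin_mem _ _ s)

/-- The coefficients with which the symbols of a file enter the symbols stored on the nodes. -/
def zigzagMatrix {R : Type*} [CommRing R] (a : Fin p → Fin k → Fin (p ^ k) → R) :
    Matrix ((Fin k ⊕ Fin p) × Fin (p ^ k)) (Fin k × Fin (p ^ k)) R :=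
  fun u v => Sum.elim (fun j => if v = (j, u.2) then 1 else 0)
    (fun l => if v.2 = zigzagIndex u.2 v.1 l then a l v.1 v.2 else 0) u.1

theorem zigzagMatrix_mulVec (x : Fin k → Fin (p ^ k) → K) (n : Fin k ⊕ Fin p)
    (t : Fin (p ^ k)) :
    (zigzagMatrix a).mulVec (fun v => x v.1 v.2) (n, t) = (zigzagCode a).content x n t := by
  rcases n with j | l
  · simp [Matrix.mulVec, dotProduct, zigzagMatrix, StorageCode.content]
  · rw [StorageCode.content, zigzagCode_parity_apply]
    simp [Matrix.mulVec, dotProduct, zigzagMatrix, Fintype.sum_prod_type]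

/-- The determinant of the map from the files to the contents of the nodes in the range of `g`. -/
def zigzagDet {R : Type*} [CommRing R] (a : Fin p → Fin k → Fin (p ^ k) → R)
    (g : Fin k ↪ Fin k ⊕ Fin p) : R :=
  ((zigzagMatrix a).submatrix (fun u : Fin k × Fin (p ^ k) => (g u.1, u.2)) id).det

/-- This serves both to specialize the generic determinant and to extend scalars from `F` to `K`. -/
theorem map_zigzagDet {R S : Type*} [CommRing R] [CommRing S] (φ : R →+* S)
    (a : Fin p → Fin k → Fin (p ^ k) → R) (g : Fin k ↪ Fin k ⊕ Fin p) :
    φ (zigzagDet a g) = zigzagDet (fun l j i => φ (a l j i)) g := by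
  rw [zigzagDet, zigzagDet, RingHom.map_det]
  congr 1
  ext u v
  simp only [RingHom.mapMatrix_apply, Matrix.map_apply, Matrix.submatrix_apply, zigzagMatrix]
  rcases g u.1 with j | l
  · simp only [Sum.elim_inl]
    split_ifs <;> simp
  · simp only [Sum.elim_inr]
    split_ifs <;> simp

theorem zigzagDet_ne_zero_iff (g : Fin k ↪ Fin k ⊕ Fin p) :
    zigzagDet a g ≠ 0 ↔ ∀ x, (∀ u, (zigzagCode a).content x (g u) = 0) → x = 0 := by
  have hrow : ∀ (x : Fin k → Fin (p ^ k) → K) (u : Fin k × Fin (p ^ k)),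
      ((zigzagMatrix a).submatrix (fun u : Fin k × Fin (p ^ k) => (g u.1, u.2)) id).mulVec
        (fun v => x v.1 v.2) u = (zigzagCode a).content x (g u.1) u.2 := fun x u =>
    zigzagMatrix_mulVec a x (g u.1) u.2
  rw [zigzagDet, Ne, ← Matrix.exists_mulVec_eq_zero_iff]
  push Not
  constructor
  · intro h x hx
    by_contra hne
    refine h (fun v => x v.1 v.2) (fun h0 => hne ?_) (funext fun u => ?_)
    · funext j i
      exact congrFun h0 (j, i)
    · rw [hrow, hx]
      rfl
  · intro h v hv h0
    refine hv ?_
    have := h (fun j i => v (j, i)) (fun u => funext fun t => by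
      rw [← hrow _ (u, t)]
      exact congrFun h0 (u, t))
    funext u
    exact congrFun (congrFun this u.1) u.2

theorem zigzagCode_isMDS_iff :
    (zigzagCode a).IsMDS ↔ ∀ g : Fin k ↪ Fin k ⊕ Fin p, zigzagDet a g ≠ 0 := by
  simp only [zigzagDet_ne_zero_iff, StorageCode.isMDS_iff_forall_embedding]

theorem zigzagCode_isMDS_algebraMap {F : Type*} [Field F] [Algebra F K]
    {a : Fin p → Fin k → Fin (p ^ k) → F} (h : (zigzagCode a).IsMDS) :
    (zigzagCode fun l j i => algebraMap F K (a l j i)).IsMDS := by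
  rw [zigzagCode_isMDS_iff] at h ⊢
  intro g
  rw [← map_zigzagDet (algebraMap F K)]
  exact (map_ne_zero _).2 (h g)

/-- With coefficients `0` and `1` the nodes in the range of `g` can be made to store, up to a
permutation of their symbols, the blocks of the file. -/
theorem exists_zigzagDet_ne_zero (g : Fin k ↪ Fin k ⊕ Fin p) :
    ∃ a : Fin p → Fin k → Fin (p ^ k) → K, zigzagDet a g ≠ 0 := by
  classical
  -- `e` matches the blocks with the nodes in the range of `g` and fixes the systematic ones.
  -- Coefficient `1` is given only to a block in its own matched parity node.
  obtain ⟨e, he⟩ := Finset.exists_equiv_extend_of_card_eq (α := Fin k)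
    (t := Finset.univ.map g) (by simp)
    (s := Finset.univ.filter fun j => Sum.inl j ∈ Finset.univ.map g) (f := Sum.inl)
    (by
      intro i hi
      simp only [Finset.mem_image, Finset.mem_filter] at hi
      obtain ⟨j, hj, rfl⟩ := hi
      exact hj.2)
    Sum.inl_injective.injOn
  refine ⟨fun l j _ => if (e j : Fin k ⊕ Fin p) = Sum.inr l then 1 else 0, ?_⟩
  rw [zigzagDet_ne_zero_iff]
  intro x hx
  have hx' : ∀ j, (zigzagCode fun l j _ => if (e j : Fin k ⊕ Fin p) = Sum.inr l then (1 : K)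
      else 0).content x (e j) = 0 := by
    intro j
    obtain ⟨u, -, hu⟩ := Finset.mem_map.1 (e j).2
    rw [← hu, hx]
  funext j
  have hj := hx' j
  rcases hej : (e j : Fin k ⊕ Fin p) with j' | l
  · have hj' := he j' (by
      rw [Finset.mem_filter, ← hej]
      exact ⟨Finset.mem_univ _, (e j).2⟩)
    have : j' = j := e.injective (Subtype.ext (hj'.trans hej.symm))
    rw [hej, this] at hj
    exact hj
  · rw [hej] at hj
    funext i
    obtain ⟨t, ht, -⟩ := exists_eq_zigzagIndex i j l
    have h0 := congrFun hj t
    rw [StorageCode.content, zigzagCode_parity_apply, Finset.sum_eq_single j] at h0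
    · rw [if_pos hej, one_mul, ← ht] at h0
      exact h0
    · intro j' _ hj'
      rw [if_neg, zero_mul]
      intro h
      exact hj' (e.injective (Subtype.ext (h.trans hej.symm)))
    · simp

-- Working over `ℤ` gives one degree bound for all characteristics. Each determinant is nonzero over
-- every `F` because some choice of coefficients makes it so; a product of degree below the order of
-- `F` then has a nonroot.
variable (k p) in
theorem exists_zigzagCode_isMDS : ∃ q₀ : ℕ, ∀ (F : Type*) [Field F] [Fintype F],
    q₀ ≤ Fintype.card F → ∃ a : Fin p → Fin k → Fin (p ^ k) → F, (zigzagCode a).IsMDS := by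
  classical
  let P : (Fin k ↪ Fin k ⊕ Fin p) → MvPolynomial (Fin p × Fin k × Fin (p ^ k)) ℤ :=
    zigzagDet fun l j i => MvPolynomial.X (l, j, i)
  have hP : ∀ {F : Type _} [Field F] (g) (b : Fin p × Fin k × Fin (p ^ k) → F),
      MvPolynomial.eval b (MvPolynomial.map (Int.castRingHom F) (P g)) =
        zigzagDet (fun l j i => b (l, j, i)) g := by
    intro F _ g b
    rw [map_zigzagDet, map_zigzagDet]
    simp
  refine ⟨(∏ g, P g).totalDegree + 1, fun F _ _ hF => ?_⟩
  have hne : MvPolynomial.map (Int.castRingHom F) (∏ g, P g) ≠ 0 := by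
    rw [map_prod, Finset.prod_ne_zero_iff]
    intro g _ h0
    obtain ⟨a, ha⟩ := exists_zigzagDet_ne_zero (K := F) g
    refine ha ?_
    rw [← hP g fun v => a v.1 v.2.1 v.2.2, h0, map_zero]
  obtain ⟨b, hb⟩ : ∃ b, MvPolynomial.eval b
      (MvPolynomial.map (Int.castRingHom F) (∏ g, P g)) ≠ 0 := by
    by_contra! h
    refine hne (MvPolynomial.eq_zero_of_eval_zero_at_prod_finset _ (fun _ => Finset.univ) ?_
      fun x _ => h x)
    intro i
    rw [Finset.card_univ]
    exact ((MvPolynomial.degreeOf_le_totalDegree _ _).trans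
      (Finset.sup_mono (MvPolynomial.support_map_subset _ _))).trans_lt hF
  refine ⟨fun l j i => b (l, j, i), (zigzagCode_isMDS_iff _).2 fun g => ?_⟩
  rw [map_prod, map_prod, Finset.prod_ne_zero_iff] at hb
  rw [← hP]
  exact hb g (Finset.mem_univ _)

variable {a}

/-- A symbol with coefficient zero would be invisible to parity `l`, against injectivity of
`parityBlock`. -/
theorem zigzagCode_coeff_ne_zero (h : (zigzagCode a).IsMDS) (l : Fin p) (j : Fin k)
    (i : Fin (p ^ k)) : a l j i ≠ 0 := by
  intro h0
  have hz : (zigzagCode a).parityBlock l j (Pi.single i 1) = 0 := by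
    funext t
    rw [StorageCode.parityBlock_apply, zigzagCode_parity_apply]
    refine Finset.sum_eq_zero fun j' _ => ?_
    rcases eq_or_ne j' j with rfl | hj
    · rw [Pi.single_eq_same]
      rcases eq_or_ne (zigzagIndex t j' l) i with hi | hi
      · rw [hi, h0, zero_mul]
      · rw [Pi.single_eq_of_ne hi, mul_zero]
    · rw [Pi.single_eq_of_ne hj, Pi.zero_apply, mul_zero]
  have := h.parityBlock_injective l j (hz.trans (map_zero _).symm)
  simpa using congrFun this i

/-- Parity `-vec i j` contains the symbol `i` of node `j` in a zigzag set whose index `t` has `j`-th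
coordinate `0`, so this parity symbol is sent. The other members of the set keep that coordinate, so
they are sent as well and can be subtracted. -/
theorem zigzagCode_repairsSystematic (h : ∀ l j i, a l j i ≠ 0) :
    (zigzagCode a).RepairsSystematic := by
  intro j x x' hx
  funext i
  obtain ⟨t, hi, ht⟩ := exists_eq_zigzagIndex i j (-vec i j)
  have ht0 : vec t j = 0 := by rw [ht]; simp
  have hpar := (zigzagCode_send_eq_iff a _ _ _ _).1 (hx (Sum.inr (-vec i j)) (by simp)) t
    (mem_repairSet.2 ht0)
  rw [StorageCode.content, StorageCode.content, zigzagCode_parity_apply,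
    zigzagCode_parity_apply, ← Finset.add_sum_erase _ _ (Finset.mem_univ j),
    ← Finset.add_sum_erase _ _ (Finset.mem_univ j), ← hi] at hpar
  have hrest : ∑ j' ∈ Finset.univ.erase j, a (-vec i j) j' (zigzagIndex t j' (-vec i j)) *
        x j' (zigzagIndex t j' (-vec i j)) =
      ∑ j' ∈ Finset.univ.erase j, a (-vec i j) j' (zigzagIndex t j' (-vec i j)) *
        x' j' (zigzagIndex t j' (-vec i j)) := by
    refine Finset.sum_congr rfl fun j' hj' => ?_
    have hne := Finset.ne_of_mem_erase hj'
    congr 1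
    refine (zigzagCode_send_eq_iff a _ _ _ _).1 (hx (Sum.inl j') (by simpa using hne)) _
      (mem_repairSet.2 ?_)
    rw [vec_zigzagIndex_of_ne t hne.symm, ht0]
  rw [hrest] at hpar
  exact mul_left_cancel₀ (h _ _ _) (add_right_cancel hpar)

theorem zigzagCode_isMSR (hk : 0 < k) (h : (zigzagCode a).IsMDS) : (zigzagCode a).IsMSR :=
  ⟨h, zigzagCode_repairsSystematic (zigzagCode_coeff_ne_zero h), by
    rw [← pow_succ', Nat.sub_add_cancel hk]⟩

end Zigzag

/-! ### Linearized polynomials -/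

section Linearized

variable {F K : Type*} [Field F] [Fintype F] [Field K] [Algebra F K]

theorem linearizedEval_sum_mul {N : ℕ} (f : Fin N → K) {ι : Type*} (s : Finset ι) (c : ι → F)
    (w : ι → K) : linearizedEval (Fintype.card F) f (∑ u ∈ s, algebraMap F K (c u) * w u) =
      ∑ u ∈ s, algebraMap F K (c u) * linearizedEval (Fintype.card F) f (w u) := by
  have hpow : ∀ (n : ℕ) (y : K),
      y ^ Fintype.card F ^ n = (FiniteField.frobeniusAlgHom F K ^ n) y := by
    intro n y
    induction n with
    | zero => simp
    | succ n ih =>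
      rw [pow_succ (Fintype.card F), pow_mul, ih, pow_succ', AlgHom.mul_apply,
        FiniteField.coe_frobeniusAlgHom]
  simp only [linearizedEval, hpow, map_sum, map_mul, AlgHom.commutes, Finset.mul_sum]
  rw [Finset.sum_comm]
  exact Finset.sum_congr rfl fun u _ => Finset.sum_congr rfl fun i _ => mul_left_comm _ _ _

theorem linearizedEval_sub (q : ℕ) {N : ℕ} (f g : Fin N → K) (y : K) :
    linearizedEval q (f - g) y = linearizedEval q f y - linearizedEval q g y := by
  simp [linearizedEval, sub_mul]

theorem linearizedEval_append (q : ℕ) {R M : ℕ} (r : Fin R → K) (s : Fin M → K) (y : K) :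
    linearizedEval q (Fin.append r s) y =
      linearizedEval q r y + linearizedEval q (Fin.append (0 : Fin R → K) s) y := by
  simp [linearizedEval, Fin.sum_univ_add]

theorem linearizedEval_append_zero (q : ℕ) {R M : ℕ} (r : Fin R → K) (y : K) :
    linearizedEval q (Fin.append r (0 : Fin M → K)) y = linearizedEval q r y := by
  simp [linearizedEval, Fin.sum_univ_add]

/-- A linearized polynomial with `N` coefficients that vanishes at `N` linearly independent points
is zero. -/
theorem linearizedEval_eq_zero {N : ℕ} {f : Fin N → K} {ι : Type*} [Fintype ι] {w : ι → K}
    (hw : LinearIndependent F w) (hN : N ≤ Fintype.card ι)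
    (h : ∀ u, linearizedEval (Fintype.card F) f (w u) = 0) : f = 0 := by
  classical
  set q := Fintype.card F with hq
  have hq1 : 1 < q := Fintype.one_lt_card
  let P : Polynomial K := ∑ i : Fin N, Polynomial.monomial (q ^ (i : ℕ)) (f i)
  have heval : ∀ y, P.eval y = linearizedEval q f y := by
    intro y
    simp [P, linearizedEval, Polynomial.eval_finsetSum]
  have hdeg : P.natDegree < q ^ Fintype.card ι := by
    -- The degree is at most `q ^ (N - 1)`; for `N = 0` the truncated exponent would not give a
    -- strict bound when `ι` is empty.
    rcases Nat.eq_zero_or_pos N with rfl | hN0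
    · simp only [P, Finset.univ_eq_empty, Finset.sum_empty, Polynomial.natDegree_zero]
      positivity
    · refine lt_of_le_of_lt (b := q ^ (N - 1))
        (Polynomial.natDegree_sum_le_of_forall_le _ _ fun i _ =>
          (Polynomial.natDegree_monomial_le _).trans (Nat.pow_le_pow_right (by omega) ?_))
        (Nat.pow_lt_pow_right hq1 (by omega))
      have := i.2
      omega
  have hP : P = 0 := by
    -- By `F`-linearity `P` vanishes at all `q ^ card ι` combinations of the points, which are
    -- distinct by independence.
    refine Polynomial.eq_zero_of_natDegree_lt_card_of_eval_eq_zero P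
      (f := Fintype.linearCombination F w)
      hw.fintypeLinearCombination_injective ?_ ?_
    · intro c
      rw [heval, Fintype.linearCombination_apply]
      simp only [Algebra.smul_def]
      rw [linearizedEval_sum_mul]
      simp [h, ← hq]
    · simpa using hdeg
  funext i
  have := congrArg (fun Q => Polynomial.coeff Q (q ^ (i : ℕ))) hP
  simp only [P, Polynomial.finsetSum_coeff, Polynomial.coeff_monomial,
    Polynomial.coeff_zero] at this
  rw [Finset.sum_eq_single i] at this
  · simpa using this
  · intro j _ hj
    rw [if_neg]
    intro h
    exact hj (Fin.ext (Nat.pow_right_injective hq1 h))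
  · simp

/-- On at most `R` points, a linearized polynomial takes the same values as one with `R`
coefficients. -/
theorem exists_linearizedEval_eq {N R : ℕ} (f : Fin N → K) {ι : Type*} [Fintype ι] (w : ι → K)
    (hR : Fintype.card ι ≤ R) : ∃ r : Fin R → K, ∀ u,
      linearizedEval (Fintype.card F) r (w u) = linearizedEval (Fintype.card F) f (w u) := by
  -- The points may be dependent. Interpolation is done on a basis of their span and extends by
  -- `F`-linearity; the missing coefficients are zero.
  let W := Submodule.span F (Set.range w)
  have : Module.Finite F W := FiniteDimensional.span_of_finite F (Set.finite_range w)
  have hd : Module.finrank F W ≤ R := (finrank_range_le_card w).trans hR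
  obtain ⟨e, rfl⟩ := Nat.exists_eq_add_of_le hd
  let b := Module.finBasis F W
  have hb : LinearIndependent F fun u => (b u : K) :=
    b.linearIndependent.map' W.subtype W.ker_subtype
  let T : (Fin (Module.finrank F W) → K) →ₗ[K] (Fin (Module.finrank F W) → K) :=
    { toFun := fun c u => linearizedEval (Fintype.card F) c (b u : K)
      map_add' := fun c c' => by
        funext u
        simp [linearizedEval, add_mul, Finset.sum_add_distrib]
      map_smul' := fun c c' => by
        funext u
        simp [linearizedEval, mul_assoc, Finset.mul_sum] }
  have hT : Function.Injective T := by
    rw [← LinearMap.ker_eq_bot, LinearMap.ker_eq_bot']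
    intro c hc
    exact linearizedEval_eq_zero hb (by simp) fun u => congrFun hc u
  obtain ⟨c, hc⟩ := LinearMap.injective_iff_surjective.1 hT
    fun u => linearizedEval (Fintype.card F) f (b u : K)
  refine ⟨Fin.append c 0, fun v => ?_⟩
  have hv : w v = ∑ u, algebraMap F K (b.repr ⟨w v, Submodule.subset_span ⟨v, rfl⟩⟩ u) *
      (b u : K) := by
    have := congrArg W.subtype (b.sum_repr ⟨w v, Submodule.subset_span ⟨v, rfl⟩⟩)
    simp only [map_sum, map_smul, Algebra.smul_def] at this
    exact this.symm
  rw [linearizedEval_append_zero, hv, linearizedEval_sum_mul, linearizedEval_sum_mul]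
  exact Finset.sum_congr rfl fun u _ => congrArg _ (congrFun hc u)

end Linearized

/-! ### Recovery and secrecy with Gabidulin precoding -/

theorem exists_decoder {S X Y : Type*} [Nonempty S] (P : S → X → Prop) (f : X → Y)
    (h : ∀ s s' x x', P s x → P s' x' → f x = f x' → s = s') :
    ∃ dec : Y → S, ∀ s x, P s x → dec (f x) = s := by
  have hc : ∀ c, ∃ s, ∀ s' x, P s' x → f x = c → s = s' := by
    intro c
    by_cases hP : ∃ s x, P s x ∧ f x = c
    · obtain ⟨s, x, hx, rfl⟩ := hP
      exact ⟨s, fun s' x' hx' hxx => h s s' x x' hx hx' hxx.symm⟩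
    · exact ⟨Classical.arbitrary S, fun s' x hx hxc => (hP ⟨s', x, hx, hxc⟩).elim⟩
  choose dec hdec using hc
  exact ⟨dec, fun s x hx => hdec _ s x hx rfl⟩

theorem uniformOfFintype_map_equiv {A : Type*} [Fintype A] [Nonempty A] (e : A ≃ A) :
    (PMF.uniformOfFintype A).map e = PMF.uniformOfFintype A := by
  classical
  ext b
  rw [PMF.map_apply, tsum_eq_single (e.symm b)]
  · simp
  · intro c hc
    rw [if_neg]
    rintro rfl
    simp at hc

/-- If a shift of the randomness compensates for the secret in what is observed, then the law of
the observation does not depend on the secret. -/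
theorem gabidulinEncoder_map_eq {K O : Type*} [Field K] [Fintype K] {q R M k α : ℕ}
    {y : Fin k → Fin α → K} {obs : (Fin k → Fin α → K) → O} {s : Fin M → K} {r₀ : Fin R → K}
    (h : ∀ r : Fin R → K, obs (fun j i => linearizedEval q (Fin.append r s) (y j i)) =
      obs (fun j i => linearizedEval q (Fin.append (r + r₀) (0 : Fin M → K)) (y j i))) :
    (gabidulinEncoder q R M y s).map obs = (gabidulinEncoder q R M y 0).map obs := by
  rw [gabidulinEncoder, gabidulinEncoder, PMF.map_comp, PMF.map_comp]
  conv_rhs => rw [← uniformOfFintype_map_equiv (Equiv.addRight r₀), PMF.map_comp]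
  congr 1
  funext r
  exact h r

/-- Ensures that the truncated difference counting the random symbols is a true one. -/
theorem zigzagSecureSize_le {k p ℓ₁ ℓ₂ : ℕ} (hℓ : ℓ₁ + ℓ₂ < k) : zigzagSecureSize k p ℓ₁ ℓ₂ ≤ k * p ^ k := by
  refine Nat.mul_le_mul (by omega) ?_
  calc p ^ (k - ℓ₂) * (p - 1) ^ ℓ₂ ≤ p ^ (k - ℓ₂) * p ^ ℓ₂ :=
        Nat.mul_le_mul_left _ (Nat.pow_le_pow_left (Nat.sub_le _ _) _)
    _ = p ^ k := by rw [← pow_add, Nat.sub_add_cancel (by omega)]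

section Zigzag

variable {k p : ℕ} [NeZero p] {K : Type*} [Field K]

/-- The indices of the symbols that every helper sends for the repair of some node in `E`. -/
def downloadedIndices (p : ℕ) [NeZero p] {k : ℕ} (E : Finset (Fin k)) : Finset (Fin (p ^ k)) :=
  Finset.univ.filter fun i => ∃ j ∈ E, vec i j = 0

theorem mem_downloadedIndices {E : Finset (Fin k)} {i : Fin (p ^ k)} :
    i ∈ downloadedIndices p E ↔ ∃ j ∈ E, vec i j = 0 := by
  simp [downloadedIndices]

theorem card_compl_downloadedIndices (E : Finset (Fin k)) :
    (downloadedIndices p E)ᶜ.card = p ^ (k - E.card) * (p - 1) ^ E.card := by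
  classical
  have h : (downloadedIndices p E)ᶜ = (Fintype.piFinset fun j : Fin k =>
      if j ∈ E then ({0}ᶜ : Finset (Fin p)) else Finset.univ).map
        finFunctionFinEquiv.toEmbedding := by
    ext i
    obtain ⟨v, rfl⟩ := (finFunctionFinEquiv (m := p) (n := k)).surjective i
    simp only [Finset.mem_compl, mem_downloadedIndices, vec_finFunctionFinEquiv,
      Finset.mem_map_equiv, Equiv.symm_apply_apply, Fintype.mem_piFinset]
    push Not
    refine forall_congr' fun j => ?_
    by_cases hj : j ∈ E <;> simp [hj]
  rw [h, Finset.card_map, Fintype.card_piFinset]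
  have h1 : ∀ j : Fin k, (if j ∈ E then ({0}ᶜ : Finset (Fin p)) else Finset.univ).card =
      if j ∈ E then p - 1 else p := by
    intro j
    split_ifs
    · rw [Finset.card_compl, Finset.card_singleton, Fintype.card_fin]
    · simp
  rw [Finset.prod_congr rfl fun j _ => h1 j, Finset.prod_ite, Finset.prod_const,
    Finset.prod_const, Finset.filter_mem_eq_inter, Finset.univ_inter, mul_comm]
  congr 2
  have hc : Finset.univ.filter (fun j => j ∉ E) = Eᶜ := by
    ext j
    simp
  rw [hc, Finset.card_compl, Fintype.card_fin]

/-- A shift along `e_j` with `j ∉ E` leaves the coordinates in `E` alone, so zigzag sets do not mix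
downloaded and other symbols outside the blocks of `E`. -/
theorem zigzagIndex_mem_downloadedIndices {E : Finset (Fin k)} {j : Fin k} (hj : j ∉ E)
    (t : Fin (p ^ k)) (l : Fin p) :
    zigzagIndex t j l ∈ downloadedIndices p E ↔ t ∈ downloadedIndices p E := by
  simp only [mem_downloadedIndices]
  refine exists_congr fun j' => and_congr_right fun hj' => ?_
  rw [vec_zigzagIndex_of_ne t (ne_of_mem_of_not_mem hj' hj)]

variable {a : Fin p → Fin k → Fin (p ^ k) → K}

/-- When the blocks of the nodes in `E` are zero, discarding the symbols that are not downloaded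
for the repair of these nodes has the same effect on all the nodes. -/
theorem zigzagCode_content_restrict {E : Finset (Fin k)} {z : Fin k → Fin (p ^ k) → K}
    (hz : ∀ j ∈ E, z j = 0) (n : Fin k ⊕ Fin p) (t : Fin (p ^ k)) :
    (zigzagCode a).content (fun j i => if i ∈ downloadedIndices p E then z j i else 0) n t =
      if t ∈ downloadedIndices p E then (zigzagCode a).content z n t else 0 := by
  rcases n with j | l
  · rfl
  · simp only [StorageCode.content, zigzagCode_parity_apply]
    rw [Finset.ite_sum_zero]
    refine Finset.sum_congr rfl fun j _ => ?_
    by_cases hj : j ∈ E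
    · simp [hz j hj]
    · simp [zigzagIndex_mem_downloadedIndices hj]

/-- Symbols that determine the observation of the eavesdropper: for `k` nodes including the
eavesdropped ones, all the content of the latter and the downloaded symbols of the others. -/
def observedSymbols (E₁ : Finset (Fin k ⊕ Fin p)) (E₂ : Finset (Fin k))
    (B : Finset (Fin k ⊕ Fin p)) : Finset ((Fin k ⊕ Fin p) × Fin (p ^ k)) :=
  B ×ˢ Finset.univ \ (B \ (E₁ ∪ E₂.map Function.Embedding.inl)) ×ˢ (downloadedIndices p E₂)ᶜ

theorem mem_observedSymbols {E₁ B : Finset (Fin k ⊕ Fin p)} {E₂ : Finset (Fin k)}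
    {n : Fin k ⊕ Fin p} {i : Fin (p ^ k)} : (n, i) ∈ observedSymbols E₁ E₂ B ↔
      n ∈ B ∧ (n ∈ E₁ ∪ E₂.map Function.Embedding.inl ∨ i ∈ downloadedIndices p E₂) := by
  simp only [observedSymbols, Finset.mem_sdiff, Finset.mem_product, Finset.mem_univ,
    Finset.mem_compl]
  tauto

theorem card_observedSymbols_le {E₁ B : Finset (Fin k ⊕ Fin p)} {E₂ : Finset (Fin k)}
    (hB : B.card = k) (hE : E₁ ∪ E₂.map Function.Embedding.inl ⊆ B) :
    (observedSymbols E₁ E₂ B).card ≤ k * p ^ k - zigzagSecureSize k p E₁.card E₂.card := by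
  rw [observedSymbols, Finset.card_sdiff_of_subset
    (Finset.product_subset_product Finset.sdiff_subset (Finset.subset_univ _)),
    Finset.card_product, Finset.card_product, card_compl_downloadedIndices, hB,
    Finset.card_univ, Fintype.card_fin, zigzagSecureSize]
  refine Nat.sub_le_sub_left (Nat.mul_le_mul_right _ ?_) _
  -- If `E₁` meets `E₂`, more nodes of `B` remain uneavesdropped, so an inequality suffices.
  rw [Finset.card_sdiff_of_subset hE, hB]
  have := Finset.card_union_le E₁ (E₂.map (Function.Embedding.inl : Fin k ↪ Fin k ⊕ Fin p))
  rw [Finset.card_map] at this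
  omega

/-- The difference of the files, restricted to downloaded indices, is itself a file whose contents
vanish on the `k` nodes of `B`. By the MDS property it is zero, so the downloads from all nodes
agree. -/
theorem zigzagCode_observe_eq (h : (zigzagCode a).IsMDS) {E₁ B : Finset (Fin k ⊕ Fin p)}
    {E₂ : Finset (Fin k)} (hB : B.card = k) (hE : E₁ ∪ E₂.map Function.Embedding.inl ⊆ B)
    {x x' : Fin k → Fin (p ^ k) → K}
    (hx : ∀ u ∈ observedSymbols E₁ E₂ B,
      (zigzagCode a).content x u.1 u.2 = (zigzagCode a).content x' u.1 u.2) :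
    (zigzagCode a).observe E₁ E₂ x = (zigzagCode a).observe E₁ E₂ x' := by
  have hfull : ∀ n ∈ E₁ ∪ E₂.map Function.Embedding.inl,
      (zigzagCode a).content x n = (zigzagCode a).content x' n := fun n hn =>
    funext fun i => hx (n, i) (mem_observedSymbols.2 ⟨hE hn, Or.inl hn⟩)
  have hE2 : ∀ j ∈ E₂, x j = x' j := fun j hj =>
    hfull (Sum.inl j) (Finset.mem_union_right _ (Finset.mem_map_of_mem _ hj))
  have hz : ∀ j ∈ E₂, (x - x') j = 0 := fun j hj => by
    rw [Pi.sub_apply, hE2 j hj, sub_self]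
  have hrestr := zigzagCode_content_restrict (a := a) hz
  have hzero : (fun j i => if i ∈ downloadedIndices p E₂ then (x - x') j i else 0) = 0 := by
    refine h B hB _ 0 fun n hn => ?_
    rw [StorageCode.content_zero]
    funext t
    rw [hrestr]
    split_ifs with ht
    · rw [StorageCode.content_sub, Pi.sub_apply, Pi.zero_apply, sub_eq_zero]
      exact hx (n, t) (mem_observedSymbols.2 ⟨hn, Or.inr ht⟩)
    · rfl
  have hdown : ∀ n, ∀ t ∈ downloadedIndices p E₂,
      (zigzagCode a).content x n t = (zigzagCode a).content x' n t := by
    intro n t ht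
    have := hrestr n t
    rw [hzero, StorageCode.content_zero, if_pos ht, StorageCode.content_sub, Pi.sub_apply] at this
    exact sub_eq_zero.1 this.symm
  refine Prod.ext ?_ (Prod.ext ?_ ?_)
  · exact funext fun n => hfull n (Finset.mem_union_left _ n.2)
  · exact funext fun j => hE2 j j.2
  · refine funext fun j => funext fun n => ?_
    refine (zigzagCode_send_eq_iff a _ _ _ _).2 fun i hi => hdown _ _ ?_
    exact mem_downloadedIndices.2 ⟨j, j.2, mem_repairSet.1 hi⟩

/-- A code with coefficients in `F` commutes with the evaluation of linearized polynomials. -/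
theorem zigzagCode_content_linearizedEval {F : Type*} [Field F] [Fintype F] [Algebra F K]
    (a : Fin p → Fin k → Fin (p ^ k) → F) (y : Fin k → Fin (p ^ k) → K) {N : ℕ} (f : Fin N → K)
    (n : Fin k ⊕ Fin p) (t : Fin (p ^ k)) :
    (zigzagCode fun l j i => algebraMap F K (a l j i)).content
        (fun j i => linearizedEval (Fintype.card F) f (y j i)) n t =
      linearizedEval (Fintype.card F) f
        ((zigzagCode fun l j i => algebraMap F K (a l j i)).content y n t) := by
  rcases n with j | l
  · rfl
  · rw [StorageCode.content, StorageCode.content, zigzagCode_parity_apply,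
      zigzagCode_parity_apply, linearizedEval_sum_mul]

/-- Gabidulin precoding makes an MDS zigzag code achieve the secure file size. -/
theorem zigzagCode_achievesSecureSize {F : Type*} [Field F] [Fintype F] [Fintype K] [Algebra F K]
    {ℓ₁ ℓ₂ : ℕ} (hℓ : ℓ₁ + ℓ₂ < k) {a : Fin p → Fin k → Fin (p ^ k) → F}
    {y : Fin k → Fin (p ^ k) → K} (h : (zigzagCode a).IsMDS)
    (hy : LinearIndependent F (fun s : Fin k × Fin (p ^ k) => y s.1 s.2)) :
    (zigzagCode fun l j i => algebraMap F K (a l j i)).AchievesSecureSize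
      (gabidulinEncoder (Fintype.card F) (k * p ^ k - zigzagSecureSize k p ℓ₁ ℓ₂)
        (zigzagSecureSize k p ℓ₁ ℓ₂) y) ℓ₁ ℓ₂ := by
  classical
  have hK := zigzagCode_isMDS_algebraMap (K := K) h
  refine ⟨fun A hA => ?_, fun E₁ E₂ h₁ h₂ => ?_⟩
  · have hinj : ∀ s s', ∀ x ∈ (gabidulinEncoder (Fintype.card F)
          (k * p ^ k - zigzagSecureSize k p ℓ₁ ℓ₂) (zigzagSecureSize k p ℓ₁ ℓ₂) y s).support,
        ∀ x' ∈ (gabidulinEncoder (Fintype.card F)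
          (k * p ^ k - zigzagSecureSize k p ℓ₁ ℓ₂) (zigzagSecureSize k p ℓ₁ ℓ₂) y s').support,
        (∀ n ∈ A, (zigzagCode fun l j i => algebraMap F K (a l j i)).content x n =
          (zigzagCode fun l j i => algebraMap F K (a l j i)).content x' n) → s = s' := by
      intro s s' x hx x' hx' hxx
      rw [gabidulinEncoder, PMF.mem_support_map_iff] at hx hx'
      obtain ⟨r, -, rfl⟩ := hx
      obtain ⟨r', -, rfl⟩ := hx'
      have hfile := hK A hA _ _ hxx
      have hzero := linearizedEval_eq_zero (f := Fin.append r s - Fin.append r' s') hy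
        (by
          rw [Nat.sub_add_cancel (zigzagSecureSize_le hℓ)]
          simp)
        (fun u => by
          rw [linearizedEval_sub, sub_eq_zero]
          exact congrFun (congrFun hfile u.1) u.2)
      rw [sub_eq_zero] at hzero
      funext i
      simpa using congrFun hzero (Fin.natAdd _ i)
    obtain ⟨dec, hdec⟩ := exists_decoder
      (fun s x => x ∈ (gabidulinEncoder (Fintype.card F)
        (k * p ^ k - zigzagSecureSize k p ℓ₁ ℓ₂) (zigzagSecureSize k p ℓ₁ ℓ₂) y s).support)
      (fun x (n : A) => (zigzagCode fun l j i => algebraMap F K (a l j i)).content x n.1)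
      fun s s' x x' hx hx' hxx => hinj s s' x hx x' hx' fun n hn => congrFun hxx ⟨n, hn⟩
    exact ⟨dec, hdec⟩
  · refine StorageCode.mutualInfo_jointLaw_eq_zero _ _ fun s => ?_
    obtain ⟨B, hE, hB⟩ := Finset.exists_superset_card_eq
      (s := E₁ ∪ E₂.map Function.Embedding.inl) (n := k)
      ((Finset.card_union_le _ _).trans (by rw [Finset.card_map]; omega)) (by simp)
    -- `r₀` reproduces the contribution of `s` at the points behind the observed symbols.
    obtain ⟨r₀, hr₀⟩ := exists_linearizedEval_eq (F := F)
      (R := k * p ^ k - zigzagSecureSize k p ℓ₁ ℓ₂)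
      (Fin.append (0 : Fin (k * p ^ k - zigzagSecureSize k p ℓ₁ ℓ₂) → K) s)
      (fun u : observedSymbols E₁ E₂ B =>
        (zigzagCode fun l j i => algebraMap F K (a l j i)).content y u.1.1 u.1.2)
      (by
        rw [Fintype.card_coe, ← h₁, ← h₂]
        exact card_observedSymbols_le hB hE)
    refine gabidulinEncoder_map_eq (r₀ := r₀) fun r => ?_
    refine zigzagCode_observe_eq hK hB hE fun u hu => ?_
    rw [zigzagCode_content_linearizedEval, zigzagCode_content_linearizedEval,
      linearizedEval_append, linearizedEval_append_zero, ← hr₀ ⟨u, hu⟩]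
    simp [linearizedEval, add_mul, Finset.sum_add_distrib]

end Zigzag

/-! ### Closed forms of the secure file size -/

theorem cast_zigzagSecureSize {k p ℓ₁ ℓ₂ : ℕ} [NeZero p] (hℓ : ℓ₁ + ℓ₂ < k) :
    ((zigzagSecureSize k p ℓ₁ ℓ₂ : ℕ) : ℝ) =
      ((k : ℝ) - (ℓ₁ : ℝ) - (ℓ₂ : ℝ)) * (p : ℝ) ^ k * (1 - 1 / (p : ℝ)) ^ ℓ₂ := by
  have hp : (p : ℝ) ≠ 0 := Nat.cast_ne_zero.2 (NeZero.ne p)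
  have hk : (p : ℝ) ^ k = (p : ℝ) ^ (k - ℓ₂) * (p : ℝ) ^ ℓ₂ := by
    rw [← pow_add, Nat.sub_add_cancel (by omega)]
  have h1 : (p : ℝ) - 1 = p * (1 - 1 / p) := by field_simp
  rw [zigzagSecureSize, Nat.cast_mul, Nat.cast_mul, Nat.cast_pow, Nat.cast_pow,
    Nat.cast_sub (NeZero.one_le), Nat.cast_one, Nat.cast_sub (by omega), Nat.cast_sub (by omega),
    hk, h1, mul_pow]
  ring

theorem cast_zigzagSecureSize_eq_secrecyBound {k p ℓ₁ ℓ₂ : ℕ} [NeZero p] (hℓ : ℓ₁ + ℓ₂ < k)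
    (h₂ : ℓ₂ ≤ 2) : ((zigzagSecureSize k p ℓ₁ ℓ₂ : ℕ) : ℝ) =
      secrecyBound k p (p ^ k) (p ^ (k - 1)) ℓ₁ ℓ₂ := by
  have hp : (p : ℝ) ≠ 0 := Nat.cast_ne_zero.2 (NeZero.ne p)
  obtain ⟨m, rfl⟩ : ∃ m, k = m + 1 := ⟨k - 1, by omega⟩
  rw [cast_zigzagSecureSize hℓ, secrecyBound, mul_assoc, theta]
  congr 1
  interval_cases ℓ₂
  · simp
  · norm_num
    rw [pow_succ]
    field_simp
  · norm_num
    rw [pow_succ]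
    field_simp
    ring

end SecureDSS

end

theorem theorem2 (k p ℓ₁ ℓ₂ : ℕ) [NeZero p] (hℓ : ℓ₁ + ℓ₂ < k) :
    -- the secure file size
    ((zigzagSecureSize k p ℓ₁ ℓ₂ : ℕ) : ℝ)
        = ((k : ℝ) - (ℓ₁ : ℝ) - (ℓ₂ : ℝ)) * (p : ℝ) ^ k * (1 - 1 / (p : ℝ)) ^ ℓ₂ ∧
    -- over every large enough field there are coefficients that make the zigzag code MDS
    (∃ q₀ : ℕ, ∀ (F : Type*) [Field F] [Fintype F], q₀ ≤ Fintype.card F →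
      ∃ a : Fin p → Fin k → Fin (p ^ k) → F, (zigzagCode a).IsMDS) ∧
    -- the upper bound on the secure file size for `ℓ₂ ≤ 2`
    (ℓ₂ ≤ 2 → ∀ (K : Type*) [Field K] [Fintype K] (α β : ℕ),
      ∀ M ∈ secureSizes K k p α β ℓ₁ ℓ₂, (M : ℝ) ≤ secrecyBound k p α β ℓ₁ ℓ₂) ∧
    -- every MDS zigzag code with Gabidulin precoding achieves the secure file size,
    -- and this is the secrecy capacity for `ℓ₂ ≤ 2`
    (∀ (F K : Type*) [Field F] [Fintype F] [Field K] [Fintype K] [Algebra F K]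
      (a : Fin p → Fin k → Fin (p ^ k) → F) (y : Fin k → Fin (p ^ k) → K),
      (zigzagCode a).IsMDS →
      LinearIndependent F (fun s : Fin k × Fin (p ^ k) => y s.1 s.2) →
        (zigzagCode fun l j i => algebraMap F K (a l j i)).IsMSR ∧
        (zigzagCode fun l j i => algebraMap F K (a l j i)).AchievesSecureSize
          (gabidulinEncoder (Fintype.card F)
            (k * p ^ k - zigzagSecureSize k p ℓ₁ ℓ₂) (zigzagSecureSize k p ℓ₁ ℓ₂) y) ℓ₁ ℓ₂ ∧
        (ℓ₂ ≤ 2 →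
          ((zigzagSecureSize k p ℓ₁ ℓ₂ : ℕ) : ℝ)
              = secrecyBound k p (p ^ k) (p ^ (k - 1)) ℓ₁ ℓ₂ ∧
          IsGreatest (secureSizes K k p (p ^ k) (p ^ (k - 1)) ℓ₁ ℓ₂)
            (zigzagSecureSize k p ℓ₁ ℓ₂))) := by
  refine ⟨cast_zigzagSecureSize hℓ, exists_zigzagCode_isMDS k p, ?_, ?_⟩
  · intro h₂ K _ _ α β M hM
    exact le_secrecyBound_of_mem_secureSizes (NeZero.pos p) hℓ h₂ hM
  · intro F K _ _ _ _ _ a y ha hy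
    have hmsr := zigzagCode_isMSR (by omega) (zigzagCode_isMDS_algebraMap (K := K) ha)
    have hsec := zigzagCode_achievesSecureSize hℓ ha hy
    refine ⟨hmsr, hsec, fun h₂ => ?_⟩
    have hbound := cast_zigzagSecureSize_eq_secrecyBound (p := p) hℓ h₂
    refine ⟨hbound, ⟨_, hmsr, _, hsec⟩, fun M hM => ?_⟩
    have := le_secrecyBound_of_mem_secureSizes (NeZero.pos p) hℓ h₂ hM
    rw [← hbound] at this
    exact_mod_cast this
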